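/- Let $N\ge 2$ and let $\rho\in L^1(\mathbb R^N)\cap L^\infty(\mathbb R^N)$ be nonnegative and not identically zero (a.e.). For every integer $k\ge 0$ define $$\mu_k(\rho):=\inf_{S\in\mathcal S_{k+1}}\ \max_{u\in S\setminus\{0\}}\frac{\int_{\mathbb R^N}\rho|\nabla u|^2\,dx}{\int_{\mathbb R^N}\rho u^2\,dx},$$ where $\mathcal S_{k+1}$ is the family of all linear subspaces of dimension $k+1$ of $\{u\cdot 1_{\{\rho>0\}} : u\in C_c^\infty(\mathbb R^N)\}$ (functions being identified when they agree almost everywhere; for an element $u\cdot 1_{\{\rho>0\}}$ the quotient is computed with $u$, and it does not depend on the choice of $u$). Then, for every integer $k\ge 0$, $$\mu_k(\rho)\le 4\pi^2\left(\frac{(N+2)k}{2\omega_N}\,\frac{\|\rho\|_{L^\infty}}{\|\rho\|_{L^1}}\right)^{2/N},$$ where $\omega_N$ is the Lebesgue measure of the unit ball of $\mathbb R^N$. -/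

import Mathlib

open MeasureTheory
open scoped ContDiff

namespace DensityEigenvalue

/-- `u` belongs to `C_c^∞(ℝ^N)` (real valued). -/
def IsTest {N : ℕ} (u : EuclideanSpace ℝ (Fin N) → ℝ) : Prop :=
  ContDiff ℝ ∞ u ∧ HasCompactSupport u

/-- The function `u · 1_{ρ > 0}`. -/
noncomputable def cut {N : ℕ} (ρ u : EuclideanSpace ℝ (Fin N) → ℝ) :
    EuclideanSpace ℝ (Fin N) → ℝ :=
  Set.indicator {x | 0 < ρ x} u

/-- The space `{u · 1_{ρ > 0} : u ∈ C_c^∞(ℝ^N)}`, whose elements are, as usual, identified when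
they agree Lebesgue almost everywhere. -/
noncomputable def testSpace {N : ℕ} (ρ : EuclideanSpace ℝ (Fin N) → ℝ) :
    Submodule ℝ (EuclideanSpace ℝ (Fin N) →ₘ[volume] ℝ) where
  carrier := {v | ∃ u, IsTest u ∧ ⇑v =ᵐ[volume] cut ρ u}
  zero_mem' := by
    refine ⟨0, ⟨contDiff_const, HasCompactSupport.zero⟩, ?_⟩
    filter_upwards [AEEqFun.coeFn_zero (α := EuclideanSpace ℝ (Fin N)) (β := ℝ)
      (μ := volume)] with x hx
    simp [hx, cut]
  add_mem' := by
    rintro v w ⟨u, hu, hv⟩ ⟨u', hu', hw⟩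
    refine ⟨u + u', ⟨hu.1.add hu'.1, hu.2.add hu'.2⟩, ?_⟩
    filter_upwards [AEEqFun.coeFn_add v w, hv, hw] with x hx h1 h2
    simp only [hx, Pi.add_apply, h1, h2, cut, Set.indicator_add']
  smul_mem' := by
    rintro c v ⟨u, hu, hv⟩
    refine ⟨c • u, ⟨hu.1.const_smul c, hu.2.smul_left (f := fun _ => c)⟩, ?_⟩
    filter_upwards [AEEqFun.coeFn_smul c v, hv] with x hx h1
    by_cases h : 0 < ρ x <;> simp [hx, h1, cut, h]

/-- The numerator `∫ ρ |∇u|² dx` of the Rayleigh quotient. -/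
noncomputable def energy {N : ℕ} (ρ u : EuclideanSpace ℝ (Fin N) → ℝ) : ENNReal :=
  ∫⁻ x, ENNReal.ofReal (ρ x * ‖gradient u x‖ ^ 2)

/-- The denominator `∫ ρ u² dx` of the Rayleigh quotient. -/
noncomputable def mass {N : ℕ} (ρ u : EuclideanSpace ℝ (Fin N) → ℝ) : ENNReal :=
  ∫⁻ x, ENNReal.ofReal (ρ x * u x ^ 2)

/-- The gradient of a smooth function vanishes almost everywhere on its zero set. -/
theorem ae_gradient_eq_zero {N : ℕ} {u : EuclideanSpace ℝ (Fin N) → ℝ} (hu : ContDiff ℝ ∞ u) :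
    ∀ᵐ x, u x = 0 → gradient u x = 0 := by
  have hs : MeasurableSet {x | u x = 0} :=
    (isClosed_eq hu.continuous continuous_const).measurableSet
  have hd : Differentiable ℝ u := hu.differentiable (by simp)
  have key : ∀ w : EuclideanSpace ℝ (Fin N),
      ∀ᵐ x, u x = 0 → (fderiv ℝ u x).smulRight w = 0 := by
    intro w
    have ha : ApproximatesLinearOn (fun x => u x • w)
        (0 : EuclideanSpace ℝ (Fin N) →L[ℝ] EuclideanSpace ℝ (Fin N)) {x | u x = 0} 0 := by
      intro x hx y hy
      have hx' : u x = 0 := hx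
      have hy' : u y = 0 := hy
      simp [hx', hy']
    have h := ha.norm_fderiv_sub_le volume hs (fun x => (fderiv ℝ u x).smulRight w)
      (fun x _ => ((hd x).hasFDerivAt.smul_const w).hasFDerivWithinAt)
    rw [ae_restrict_iff' hs] at h
    filter_upwards [h] with x hx h0
    have h1 := hx h0
    rwa [nonpos_iff_eq_zero, nnnorm_eq_zero, sub_zero] at h1
  have key' := ae_all_iff.2 fun i : Fin N => key (EuclideanSpace.single i 1)
  filter_upwards [key'] with x hx h0
  have hz : fderiv ℝ u x = 0 := by
    ext y
    obtain hN | ⟨⟨i⟩⟩ := isEmpty_or_nonempty (Fin N)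
    · rw [Subsingleton.elim y 0]; simp
    · have := congrArg (fun L => (L y) i) (hx i h0)
      simpa using this
  simp [gradient, hz]

/-- `∫ ρ |∇u|² dx` depends only on the class of `u · 1_{ρ > 0}`. -/
theorem energy_congr {N : ℕ} {ρ u w : EuclideanSpace ℝ (Fin N) → ℝ} (hu : IsTest u)
    (hw : IsTest w) (h : cut ρ u =ᵐ[volume] cut ρ w) : energy ρ u = energy ρ w := by
  refine lintegral_congr_ae ?_
  filter_upwards [h, ae_gradient_eq_zero (hu.1.sub hw.1)] with x hx hg
  by_cases hρ : 0 < ρ x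
  · have hx' : u x = w x := by simpa [cut, hρ] using hx
    have hd : gradient (fun y => u y - w y) x = 0 := hg (by simp [hx'])
    have e : gradient (fun y => u y - w y) x = gradient u x - gradient w x := by
      simp only [gradient]
      rw [fderiv_fun_sub (hu.1.differentiable (by simp) x) (hw.1.differentiable (by simp) x),
        map_sub]
    rw [e, sub_eq_zero] at hd
    rw [hd]
  · have : ∀ t : ℝ, ENNReal.ofReal (ρ x * t ^ 2) = 0 := fun t =>
      ENNReal.ofReal_of_nonpos (mul_nonpos_of_nonpos_of_nonneg (not_lt.1 hρ) (sq_nonneg t))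
    simp only [this]

/-- The maximum over `S \ {0}` of the Rayleigh quotient `∫ ρ |∇u|² dx / ∫ ρ u² dx`, where
`S` is a space of classes of functions `u · 1_{ρ > 0}`. All the `u ∈ C_c^∞` that represent
the same element of `S` give the same quotient, by `energy_congr`. -/
noncomputable def maxRayleigh {N : ℕ} (ρ : EuclideanSpace ℝ (Fin N) → ℝ)
    (S : Submodule ℝ (EuclideanSpace ℝ (Fin N) →ₘ[volume] ℝ)) : ENNReal :=
  ⨆ (u : EuclideanSpace ℝ (Fin N) → ℝ) (_ : IsTest u)
    (_ : ∃ v ∈ S, v ≠ 0 ∧ ⇑v =ᵐ[volume] cut ρ u), energy ρ u / mass ρ u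

/-- The `k`-th eigenvalue `μ_k(ρ)` of an integrable density `ρ ≥ 0` on `ℝ^N`: the infimum of
`maxRayleigh ρ S` over the subspaces `S` of dimension `k + 1` of `testSpace ρ`. It is `⊤` if
there is no such `S`, in particular for `ρ = 0`. -/
noncomputable def eigenvalue {N : ℕ} (k : ℕ) (ρ : EuclideanSpace ℝ (Fin N) → ℝ) : ENNReal :=
  ⨅ (S : Submodule ℝ (EuclideanSpace ℝ (Fin N) →ₘ[volume] ℝ)) (_ : S ≤ testSpace ρ)
    (_ : Module.finrank ℝ S = k + 1), maxRayleigh ρ S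

/-- The volume `ω_N` of the unit ball of `ℝ^N`. -/
noncomputable def unitBallVolume (N : ℕ) : ℝ :=
  (volume (Metric.ball (0 : EuclideanSpace ℝ (Fin N)) 1)).toReal

end DensityEigenvalue

/-! This is Kröger's argument for Neumann eigenvalues, with complex exponentials as trial functions.
If `μ < μ_k(ρ)`, every finite family of test functions admits at most `k` functions `φ` of mass one
with `μ (∫ρu² - ∑_φ (∫ρφu)²) ≤ ∫ρ|∇u|²` on the family (`exists_finset_test_of_lt_eigenvalue`). Only
a finite-dimensional diagonalization is needed, so no eigenfunctions of `ρ` itself have to exist.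

Take `u = χ cos⟨z,·⟩` and `χ sin⟨z,·⟩` with a cutoff `χ`, and sum over the frequencies `z ∈ n⁻¹ℤ^N`
with `|z| ≤ r`. Each pair has total mass `∫ρχ²` and total energy `∫ρ|∇χ|² + |z|²∫ρχ²`. The
subtracted terms are squared Fourier coefficients of `ρφχ` on a cube of side `2πn`, so Bessel bounds
their sum by `(2πn)^N ‖ρ‖_∞` for each `φ` (`sum_massForm_cosTest_sinTest_sq_le`).

Dividing by `n^N` and letting `n → ∞` while `χ → 1` turns the sums into integrals over a ball
(`mul_volume_sub_le_of_lt_eigenvalue`): with `m = ∫ρ`, `μ (ω_N r^N m - k (2π)^N ‖ρ‖_∞) ≤ ω_N N/(N+2)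
r^(N+2) m`. The best `r` gives the theorem. -/

namespace DensityEigenvalue

/-! ### Diagonalization of one quadratic form relative to another. -/

section Spectral

variable {V : Type*} [NormedAddCommGroup V] [InnerProductSpace ℝ V] [FiniteDimensional ℝ V]

theorem inner_apply_self_eq_sum_eigenvalues {T : V →ₗ[ℝ] V} (hT : T.IsSymmetric) (u : V) :
    inner ℝ (T u) u = ∑ j, hT.eigenvalues rfl j * inner ℝ (hT.eigenvectorBasis rfl j) u ^ 2 := by
  rw [← (hT.eigenvectorBasis rfl).sum_inner_mul_inner (T u) u]
  refine Finset.sum_congr rfl fun j _ => ?_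
  rw [hT, hT.apply_eigenvectorBasis, inner_smul_right, real_inner_comm, pow_two, ← mul_assoc]
  rfl

/-- A nonnegative symmetric operator that exceeds `μ` somewhere on every subspace of dimension
`k + 1` is bounded below by `μ` times the projection off some `k` unit vectors. -/
theorem exists_finset_unit_of_exceeds {T : V →ₗ[ℝ] V} (hT : T.IsSymmetric)
    (hpos : ∀ u, 0 ≤ inner ℝ (T u) u) {μ : ℝ} {k : ℕ}
    (hk : ∀ S : Submodule ℝ V, Module.finrank ℝ S = k + 1 →
      ∃ u ∈ S, μ * inner ℝ u u < inner ℝ (T u) u) :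
    ∃ s : Finset V, s.card ≤ k ∧ (∀ φ ∈ s, inner ℝ φ φ = (1 : ℝ)) ∧
      ∀ u, μ * (inner ℝ u u - ∑ φ ∈ s, inner ℝ φ u ^ 2) ≤ inner ℝ (T u) u := by
  classical
  set b := hT.eigenvectorBasis rfl with hb
  set l := hT.eigenvalues rfl with hl
  have hself : ∀ u : V, inner ℝ u u = ∑ j, inner ℝ (b j) u ^ 2 := fun u => by
    rw [← b.sum_inner_mul_inner u u]
    exact Finset.sum_congr rfl fun j _ => by rw [real_inner_comm u, pow_two]
  have hbj : ∀ j, inner ℝ (b j) (b j) = (1 : ℝ) := fun j => by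
    rw [real_inner_self_eq_norm_sq, b.orthonormal.1 j, one_pow]
  have hlpos : ∀ j, 0 ≤ l j := fun j => by
    have h := hpos (b j)
    rwa [hb, hT.apply_eigenvectorBasis, inner_smul_left, ← hb, hbj, mul_one] at h
  -- The chosen unit vectors are the eigenvectors with eigenvalue at most `μ`. If there were `k + 1`
  -- of them, `T` would not exceed `μ` anywhere on their span, against `hk`.
  set J : Finset (Fin _) := Finset.univ.filter fun j => l j ≤ μ with hJ
  refine ⟨J.image b, ?_, ?_, fun u => ?_⟩
  · refine Finset.card_image_le.trans ?_
    by_contra! hlt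
    obtain ⟨J', hJ', hcard⟩ := Finset.exists_subset_card_eq (Nat.succ_le_of_lt hlt)
    obtain ⟨u, hu, hlt'⟩ := hk (Submodule.span ℝ (Set.range (b ∘ ((↑) : J' → _)))) (by
      rw [finrank_span_eq_card (b.orthonormal.linearIndependent.comp _ Subtype.val_injective)]
      simpa using hcard)
    refine hlt'.not_ge ?_
    clear hlt'
    have hzero : ∀ j, j ∉ J' → inner ℝ (b j) u = (0 : ℝ) := fun j hj => by
      induction hu using Submodule.span_induction with
      | mem x hx =>
        obtain ⟨i, rfl⟩ := hx
        exact b.orthonormal.2 fun h => hj (h ▸ i.2)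
      | zero => simp
      | add x y _ _ hx hy => rw [inner_add_right, hx, hy, add_zero]
      | smul c x _ hx => rw [inner_smul_right, hx, mul_zero]
    rw [inner_apply_self_eq_sum_eigenvalues hT, hself, Finset.mul_sum]
    refine Finset.sum_le_sum fun j _ => ?_
    by_cases hj : j ∈ J'
    · exact mul_le_mul_of_nonneg_right (Finset.mem_filter.1 (hJ' hj)).2 (sq_nonneg _)
    · have := hzero j hj
      rw [← hb, this]; simp
  · intro φ hφ
    obtain ⟨j, -, rfl⟩ := Finset.mem_image.1 hφ
    exact hbj j
  · rw [Finset.sum_image fun i _ j _ h => b.toBasis.injective (by simpa using h),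
      inner_apply_self_eq_sum_eigenvalues hT, hself, hJ, Finset.sum_filter,
      ← Finset.sum_sub_distrib, Finset.mul_sum]
    refine Finset.sum_le_sum fun j _ => ?_
    -- On `J` the coordinate cancels from the left side and nonnegativity of the eigenvalue
    -- suffices; off `J` the eigenvalue exceeds `μ`.
    split_ifs with h
    · simpa using mul_nonneg (hlpos j) (sq_nonneg _)
    · rw [sub_zero]
      exact mul_le_mul_of_nonneg_right (not_le.1 h).le (sq_nonneg _)

end Spectral

/-- Simultaneous diagonalization of a positive definite and a nonnegative form: if the second
exceeds `μ` times the first somewhere on every subspace of dimension `k + 1`, then this holds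
everywhere up to `k` coordinates. -/
theorem exists_finset_unit_of_form_exceeds {V : Type*} [AddCommGroup V] [Module ℝ V]
    [FiniteDimensional ℝ V] (B E : LinearMap.BilinForm ℝ V) (hB : ∀ u v, B u v = B v u)
    (hBpos : ∀ u, u ≠ 0 → 0 < B u u) (hE : ∀ u v, E u v = E v u) (hEpos : ∀ u, 0 ≤ E u u)
    {μ : ℝ} {k : ℕ} (hk : ∀ S : Submodule ℝ V, Module.finrank ℝ S = k + 1 →
      ∃ u ∈ S, μ * B u u < E u u) :
    ∃ s : Finset V, s.card ≤ k ∧ (∀ φ ∈ s, B φ φ = 1) ∧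
      ∀ u, μ * (B u u - ∑ φ ∈ s, B φ u ^ 2) ≤ E u u := by
  have hdef : ∀ u, B u u = 0 → u = 0 := fun u h => by
    by_contra hne
    exact (hBpos u hne).ne' h
  have hnd : B.Nondegenerate := by
    refine ⟨fun u h => hdef u (h u), fun u h => hdef u (h u)⟩
  let c : InnerProductSpace.Core ℝ V :=
    { inner := fun u v => B u v
      conj_inner_symm := fun u v => hB v u
      re_inner_nonneg := fun u => by
        by_cases h : u = 0
        · simp [h]
        · exact (hBpos u h).le
      add_left := fun u v w => by simp
      smul_left := fun u v r => by simp
      definite := hdef }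
  let := c.toNormedAddCommGroup
  let : InnerProductSpace ℝ V := InnerProductSpace.ofCore c.toCore
  -- `T` represents `E` in the inner product `B`, so its spectrum is that of `E` relative to `B`.
  let T : V →ₗ[ℝ] V := LinearMap.BilinForm.symmCompOfNondegenerate E B hnd
  have hTE : ∀ u v, inner ℝ (T u) v = E u v := fun u v =>
    LinearMap.BilinForm.symmCompOfNondegenerate_left_apply E hnd v u
  have hT : T.IsSymmetric := fun u v => by
    rw [hTE, real_inner_comm, hTE, hE]
  obtain ⟨s, h1, h2, h3⟩ := exists_finset_unit_of_exceeds hT (fun u => by rw [hTE]; exact hEpos u)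
    (μ := μ) (k := k) (fun S hS => by
      obtain ⟨u, hu, h⟩ := hk S hS
      exact ⟨u, hu, by rw [hTE]; exact h⟩)
  exact ⟨s, h1, h2, fun u => by rw [← hTE]; exact h3 u⟩

/-! ### Mass and energy forms on test functions, and the variational principle. -/

variable {N : ℕ}

/-- The space `C_c^∞(ℝ^N)`. -/
def testFunctions (N : ℕ) : Submodule ℝ (EuclideanSpace ℝ (Fin N) → ℝ) where
  carrier := {u | IsTest u}
  zero_mem' := ⟨contDiff_const, HasCompactSupport.zero⟩
  add_mem' hu hv := ⟨hu.1.add hv.1, hu.2.add hv.2⟩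
  smul_mem' c _ hu := ⟨hu.1.const_smul c, hu.2.smul_left (f := fun _ => c)⟩

theorem isTest_coe (u : testFunctions N) : IsTest (u : EuclideanSpace ℝ (Fin N) → ℝ) :=
  u.2

theorem integrable_mul_of_hasCompactSupport {ρ f : EuclideanSpace ℝ (Fin N) → ℝ}
    (hρ : Integrable ρ) (hf : Continuous f) (hc : HasCompactSupport f) :
    Integrable fun x => ρ x * f x := by
  obtain ⟨C, hC⟩ := hc.exists_bound_of_continuous hf
  exact hρ.mul_bdd hf.aestronglyMeasurable (Filter.Eventually.of_forall hC)

theorem IsTest.continuous_gradient {u : EuclideanSpace ℝ (Fin N) → ℝ} (hu : IsTest u) :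
    Continuous (gradient u) :=
  (LinearIsometryEquiv.continuous _).comp (hu.1.continuous_fderiv (by simp))

theorem IsTest.hasCompactSupport_gradient {u : EuclideanSpace ℝ (Fin N) → ℝ} (hu : IsTest u) :
    HasCompactSupport (gradient u) :=
  (hu.2.fderiv ℝ).comp_left (map_zero _)

theorem IsTest.differentiable {u : EuclideanSpace ℝ (Fin N) → ℝ} (hu : IsTest u) :
    Differentiable ℝ u :=
  hu.1.differentiable (by simp)

theorem gradient_add_apply {u v : EuclideanSpace ℝ (Fin N) → ℝ} (hu : Differentiable ℝ u)
    (hv : Differentiable ℝ v) (x : EuclideanSpace ℝ (Fin N)) :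
    gradient (u + v) x = gradient u x + gradient v x := by
  simp only [gradient]
  rw [fderiv_add (hu x) (hv x), map_add]

theorem gradient_smul_apply {u : EuclideanSpace ℝ (Fin N) → ℝ} (hu : Differentiable ℝ u)
    (c : ℝ) (x : EuclideanSpace ℝ (Fin N)) : gradient (c • u) x = c • gradient u x := by
  simp only [gradient]
  rw [fderiv_const_smul (hu x), map_smul]

section Forms

variable {ρ : EuclideanSpace ℝ (Fin N) → ℝ}

theorem integrable_mass (hρ : Integrable ρ) (u v : testFunctions N) :
    Integrable fun x => ρ x * (u.1 x * v.1 x) :=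
  integrable_mul_of_hasCompactSupport hρ (u.2.1.continuous.mul v.2.1.continuous) u.2.2.mul_right

theorem integrable_energy (hρ : Integrable ρ) (u v : testFunctions N) :
    Integrable fun x => ρ x * inner ℝ (gradient u.1 x) (gradient v.1 x) := by
  refine integrable_mul_of_hasCompactSupport hρ
    ((isTest_coe u).continuous_gradient.inner (isTest_coe v).continuous_gradient) ?_
  exact (isTest_coe u).hasCompactSupport_gradient.mono fun x hx h => hx (by simp [h])

/-- The form `∫ ρ u v`. -/
noncomputable def massForm (hρ : Integrable ρ) : LinearMap.BilinForm ℝ (testFunctions N) :=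
  LinearMap.mk₂ ℝ (fun u v => ∫ x, ρ x * (u.1 x * v.1 x))
    (fun u u' v => by
      rw [← integral_add (integrable_mass hρ u v) (integrable_mass hρ u' v)]
      congr 1; ext x; simp; ring)
    (fun c u v => by
      rw [smul_eq_mul, ← integral_const_mul]
      congr 1; ext x; simp; ring)
    (fun u v v' => by
      rw [← integral_add (integrable_mass hρ u v) (integrable_mass hρ u v')]
      congr 1; ext x; simp; ring)
    (fun c u v => by
      rw [smul_eq_mul, ← integral_const_mul]
      congr 1; ext x; simp; ring)

theorem massForm_apply (hρ : Integrable ρ) (u v : testFunctions N) :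
    massForm hρ u v = ∫ x, ρ x * (u.1 x * v.1 x) := rfl

/-- The form `∫ ρ ∇u · ∇v`. -/
noncomputable def energyForm (hρ : Integrable ρ) : LinearMap.BilinForm ℝ (testFunctions N) :=
  LinearMap.mk₂ ℝ (fun u v => ∫ x, ρ x * inner ℝ (gradient u.1 x) (gradient v.1 x))
    (fun u u' v => by
      rw [← integral_add (integrable_energy hρ u v) (integrable_energy hρ u' v)]
      congr 1; ext x
      rw [Submodule.coe_add, gradient_add_apply (isTest_coe u).differentiable (isTest_coe u').differentiable,
        inner_add_left, mul_add])
    (fun c u v => by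
      rw [smul_eq_mul, ← integral_const_mul]
      congr 1; ext x
      rw [Submodule.coe_smul, gradient_smul_apply (isTest_coe u).differentiable, real_inner_smul_left]
      ring)
    (fun u v v' => by
      rw [← integral_add (integrable_energy hρ u v) (integrable_energy hρ u v')]
      congr 1; ext x
      rw [Submodule.coe_add, gradient_add_apply (isTest_coe v).differentiable (isTest_coe v').differentiable,
        inner_add_right, mul_add])
    (fun c u v => by
      rw [smul_eq_mul, ← integral_const_mul]
      congr 1; ext x
      rw [Submodule.coe_smul, gradient_smul_apply (isTest_coe v).differentiable, real_inner_smul_right]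
      ring)

theorem energyForm_apply (hρ : Integrable ρ) (u v : testFunctions N) :
    energyForm hρ u v = ∫ x, ρ x * inner ℝ (gradient u.1 x) (gradient v.1 x) := rfl

theorem energyForm_self (hρ : Integrable ρ) (u : testFunctions N) :
    energyForm hρ u u = ∫ x, ρ x * ‖gradient u.1 x‖ ^ 2 := by
  simp only [energyForm_apply, real_inner_self_eq_norm_sq]

theorem massForm_self_nonneg (hρ : Integrable ρ) (h0 : 0 ≤ᵐ[volume] ρ) (u : testFunctions N) :
    0 ≤ massForm hρ u u := by
  rw [massForm_apply]
  refine integral_nonneg_of_ae ?_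
  filter_upwards [h0] with x hx using mul_nonneg hx (mul_self_nonneg _)

theorem energyForm_self_nonneg (hρ : Integrable ρ) (h0 : 0 ≤ᵐ[volume] ρ) (u : testFunctions N) :
    0 ≤ energyForm hρ u u := by
  rw [energyForm_self]
  refine integral_nonneg_of_ae ?_
  filter_upwards [h0] with x hx using mul_nonneg hx (sq_nonneg _)

theorem mass_eq_massForm (hρ : Integrable ρ) (h0 : 0 ≤ᵐ[volume] ρ) (u : testFunctions N) :
    mass ρ u.1 = ENNReal.ofReal (massForm hρ u u) := by
  rw [massForm_apply, ofReal_integral_eq_lintegral_ofReal (integrable_mass hρ u u)]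
  · simp only [mass, pow_two]
  · filter_upwards [h0] with x hx using mul_nonneg hx (mul_self_nonneg _)

theorem energy_eq_energyForm (hρ : Integrable ρ) (h0 : 0 ≤ᵐ[volume] ρ) (u : testFunctions N) :
    energy ρ u.1 = ENNReal.ofReal (energyForm hρ u u) := by
  rw [energyForm_apply, ofReal_integral_eq_lintegral_ofReal (integrable_energy hρ u u)]
  · simp only [energy, real_inner_self_eq_norm_sq]
  · filter_upwards [h0] with x hx using mul_nonneg hx (real_inner_self_nonneg)

theorem aestronglyMeasurable_cut (hρ : Integrable ρ) (u : testFunctions N) :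
    AEStronglyMeasurable (cut ρ u.1) volume :=
  u.2.1.continuous.aestronglyMeasurable.indicator₀
    (nullMeasurableSet_lt aemeasurable_const hρ.aemeasurable)

/-- The class of `u · 1_{ρ > 0}`. -/
noncomputable def cutClass (hρ : Integrable ρ) :
    testFunctions N →ₗ[ℝ] (EuclideanSpace ℝ (Fin N) →ₘ[volume] ℝ) where
  toFun u := AEEqFun.mk (cut ρ u.1) (aestronglyMeasurable_cut hρ u)
  map_add' u v := by
    rw [AEEqFun.mk_add_mk, AEEqFun.mk_eq_mk]
    exact Filter.Eventually.of_forall fun x => by simp [cut, Set.indicator_add']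
  map_smul' c u := by
    rw [RingHom.id_apply, AEEqFun.smul_mk c (cut ρ u.1) (aestronglyMeasurable_cut hρ u),
      AEEqFun.mk_eq_mk]
    exact Filter.Eventually.of_forall fun x => by by_cases h : 0 < ρ x <;> simp [cut, h]

theorem coeFn_cutClass (hρ : Integrable ρ) (u : testFunctions N) :
    cutClass hρ u =ᵐ[volume] cut ρ u.1 :=
  AEEqFun.coeFn_mk _ _

theorem cutClass_mem_testSpace (hρ : Integrable ρ) (u : testFunctions N) :
    cutClass hρ u ∈ testSpace ρ :=
  ⟨u.1, u.2, coeFn_cutClass hρ u⟩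

theorem massForm_congr (hρ : Integrable ρ) (h0 : 0 ≤ᵐ[volume] ρ) (φ : testFunctions N)
    {u v : testFunctions N} (h : cut ρ u.1 =ᵐ[volume] cut ρ v.1) :
    massForm hρ φ u = massForm hρ φ v := by
  refine integral_congr_ae ?_
  filter_upwards [h, h0] with x hx h0
  rcases eq_or_lt_of_le h0 with h0 | h0
  · simp only [← h0, Pi.zero_apply, zero_mul]
  · have h0' : 0 < ρ x := h0
    simp only [cut, Set.indicator, Set.mem_ofPred_eq, h0', if_true] at hx
    rw [hx]

theorem massForm_comm (hρ : Integrable ρ) (u v : testFunctions N) :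
    massForm hρ u v = massForm hρ v u := by
  simp only [massForm_apply, mul_comm (u.1 _)]

theorem energyForm_comm (hρ : Integrable ρ) (u v : testFunctions N) :
    energyForm hρ u v = energyForm hρ v u := by
  simp only [energyForm_apply, real_inner_comm (gradient v.1 _)]

theorem energyForm_self_congr (hρ : Integrable ρ) (h0 : 0 ≤ᵐ[volume] ρ)
    {u v : testFunctions N} (h : cut ρ u.1 =ᵐ[volume] cut ρ v.1) :
    energyForm hρ u u = energyForm hρ v v := by
  have := energy_congr u.2 v.2 h
  rwa [energy_eq_energyForm hρ h0, energy_eq_energyForm hρ h0,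
    ENNReal.ofReal_eq_ofReal_iff (energyForm_self_nonneg hρ h0 _)
      (energyForm_self_nonneg hρ h0 _)] at this

/-- The mass form is only semidefinite on test functions. Its null functions vanish almost
everywhere on `{ρ > 0}`, so it becomes definite on classes. -/
theorem cutClass_eq_zero_of_massForm (hρ : Integrable ρ) (h0 : 0 ≤ᵐ[volume] ρ)
    {u : testFunctions N} (h : massForm hρ u u = 0) : cutClass hρ u = 0 := by
  rw [massForm_apply, integral_eq_zero_iff_of_nonneg_ae ?_ (integrable_mass hρ u u)] at h
  · refine AEEqFun.ext ((coeFn_cutClass hρ u).trans (.trans ?_ AEEqFun.coeFn_zero.symm))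
    filter_upwards [h] with x hx
    by_cases hx0 : 0 < ρ x
    · simpa [cut, hx0, hx0.ne'] using hx
    · simp [cut, hx0]
  · filter_upwards [h0] with x hx using mul_nonneg hx (mul_self_nonneg _)

/-- If `μ < μ_k(ρ)`, then on every finite set of test functions the energy is bounded below by `μ`
times the mass, up to the components along some `k` test functions. -/
theorem exists_finset_test_of_lt_eigenvalue (hρ : Integrable ρ) (h0 : 0 ≤ᵐ[volume] ρ)
    {μ : ℝ} (hμ : 0 ≤ μ) {k : ℕ} (hlt : ENNReal.ofReal μ < eigenvalue k ρ)
    (s : Finset (testFunctions N)) :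
    ∃ t : Finset (testFunctions N), t.card ≤ k ∧ (∀ φ ∈ t, massForm hρ φ φ = 1) ∧
      ∀ u ∈ s, μ * (massForm hρ u u - ∑ φ ∈ t, massForm hρ φ u ^ 2) ≤ energyForm hρ u u := by
  classical
  set W := (Submodule.span ℝ (s : Set (testFunctions N))).map (cutClass hρ) with hW
  have hWr : W ≤ LinearMap.range (cutClass hρ) := LinearMap.map_le_range
  -- A linear choice `σ` of smooth representatives pulls both forms back to bilinear forms on `W`,
  -- where the mass is positive definite.
  obtain ⟨σ, hσ⟩ := Module.projective_lifting_property (cutClass hρ).rangeRestrict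
    (Submodule.inclusion hWr) (LinearMap.surjective_rangeRestrict _)
  have hσ' : ∀ w : W, cutClass hρ (σ w) = w := fun w =>
    congrArg Subtype.val (LinearMap.congr_fun hσ w)
  have hcut : ∀ w : W, cut ρ (σ w).1 =ᵐ[volume] (w : EuclideanSpace ℝ (Fin N) →ₘ[volume] ℝ) :=
    fun w => by
      have := coeFn_cutClass hρ (σ w)
      rw [hσ'] at this
      exact this.symm
  have hpos : ∀ w : W, w ≠ 0 → 0 < massForm hρ (σ w) (σ w) := fun w hw => by
    refine lt_of_le_of_ne (massForm_self_nonneg hρ h0 _) fun h => hw ?_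
    have := cutClass_eq_zero_of_massForm hρ h0 h.symm
    rw [hσ'] at this
    exact Subtype.ext this
  obtain ⟨t, ht1, ht2, ht3⟩ := exists_finset_unit_of_form_exceeds (V := W)
    ((massForm hρ).compl₁₂ σ σ) ((energyForm hρ).compl₁₂ σ σ)
    (fun u v => massForm_comm hρ _ _) hpos (fun u v => energyForm_comm hρ _ _)
    (fun u => energyForm_self_nonneg hρ h0 _) (μ := μ) (k := k) (fun S hS => by
      have h1 : S.map W.subtype ≤ testSpace ρ := by
        rintro _ ⟨w, -, rfl⟩
        rw [Submodule.subtype_apply, ← hσ']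
        exact cutClass_mem_testSpace hρ _
      have h2 : Module.finrank ℝ (S.map W.subtype) = k + 1 := by
        rw [← hS]
        exact (Submodule.equivMapOfInjective _ W.injective_subtype S).finrank_eq.symm
      have h3 : ENNReal.ofReal μ < maxRayleigh ρ (S.map W.subtype) :=
        hlt.trans_le (iInf_le_of_le _ (iInf_le_of_le h1 (iInf_le_of_le h2 le_rfl)))
      simp only [maxRayleigh, lt_iSup_iff] at h3
      obtain ⟨u, hu, ⟨_, ⟨w, hwS, rfl⟩, hw0, hwu⟩, hlt'⟩ := h3
      refine ⟨w, hwS, ?_⟩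
      have hw0' : w ≠ 0 := fun h => hw0 (by simp [h])
      -- The function `u` supplied by the supremum need not be `σ w`, but both represent the same
      -- class and so have the same mass and energy.
      have hc : cut ρ u =ᵐ[volume] cut ρ (σ w).1 := hwu.symm.trans (hcut w).symm
      let u' : testFunctions N := ⟨u, hu⟩
      have hm : massForm hρ u' u' = massForm hρ (σ w) (σ w) := by
        rw [massForm_congr hρ h0 u' (v := σ w) hc, massForm_comm,
          massForm_congr hρ h0 (σ w) (v := σ w) hc]
      rw [show energy ρ u = _ from energy_eq_energyForm hρ h0 u',
        show mass ρ u = _ from mass_eq_massForm hρ h0 u', hm,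
        energyForm_self_congr hρ h0 (v := σ w) hc,
        ← ENNReal.ofReal_div_of_pos (hpos w hw0'), ENNReal.ofReal_lt_ofReal_iff_of_nonneg hμ,
        lt_div_iff₀ (hpos w hw0')] at hlt'
      exact hlt')
  have hσinj : Function.Injective σ := fun v w h => Subtype.ext (by rw [← hσ', ← hσ', h])
  refine ⟨t.image σ, Finset.card_image_le.trans ht1, fun φ hφ => ?_, fun u hu => ?_⟩
  · obtain ⟨w, hw, rfl⟩ := Finset.mem_image.1 hφ
    exact ht2 w hw
  · let w : W := ⟨cutClass hρ u, Submodule.mem_map_of_mem (Submodule.subset_span hu)⟩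
    have hc : cut ρ u.1 =ᵐ[volume] cut ρ (σ w).1 :=
      (coeFn_cutClass hρ u).symm.trans (hcut w).symm
    have hm : massForm hρ u u = massForm hρ (σ w) (σ w) := by
      rw [massForm_congr hρ h0 u hc, massForm_comm, massForm_congr hρ h0 (σ w) hc]
    have h := ht3 w
    simp only [LinearMap.compl₁₂_apply] at h
    rw [Finset.sum_image fun v _ w _ h => hσinj h, energyForm_self_congr hρ h0 hc, hm]
    simpa only [massForm_congr hρ h0 _ hc] using h

end Forms

/-! ### Bessel's inequality for lattice exponentials on a cube. -/

/-- Bessel's inequality for functions. -/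
theorem sum_norm_integral_conj_mul_sq_le {α ι : Type*} [MeasurableSpace α] {ν : Measure α}
    [DecidableEq ι] (s : Finset ι) {e : ι → α → ℂ} (he : ∀ i, MemLp (e i) 2 ν) {c : ℝ} (hc : 0 < c)
    (horth : ∀ i j, ∫ x, e j x * starRingEnd ℂ (e i x) ∂ν = if i = j then (c : ℂ) else 0)
    {f : α → ℂ} (hf : MemLp f 2 ν) :
    ∑ i ∈ s, ‖∫ x, f x * starRingEnd ℂ (e i x) ∂ν‖ ^ 2 ≤ c * ∫ x, ‖f x‖ ^ 2 ∂ν := by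
  have hinner : ∀ {g h : α → ℂ} (hg : MemLp g 2 ν) (hh : MemLp h 2 ν),
      inner ℂ (hg.toLp g) (hh.toLp h) = ∫ x, h x * starRingEnd ℂ (g x) ∂ν := fun hg hh => by
    rw [L2.inner_def]
    refine integral_congr_ae ?_
    filter_upwards [hg.coeFn_toLp, hh.coeFn_toLp] with x h1 h2
    rw [h1, h2]
    rfl
  have hcs : ((√c : ℝ) : ℂ)⁻¹ * ((√c : ℝ) : ℂ)⁻¹ = (c : ℂ)⁻¹ := by
    rw [← mul_inv, ← Complex.ofReal_mul, Real.mul_self_sqrt hc.le]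
  have hon : Orthonormal ℂ fun i => ((√c : ℝ) : ℂ)⁻¹ • (he i).toLp (e i) := by
    rw [orthonormal_iff_ite]
    intro i j
    rw [inner_smul_left, inner_smul_right, hinner, horth, ← mul_assoc, map_inv₀,
      Complex.conj_ofReal, hcs]
    split_ifs
    · exact inv_mul_cancel₀ (by exact_mod_cast hc.ne')
    · rw [mul_zero]
  have h := hon.sum_inner_products_le (hf.toLp f) (s := s)
  have hnorm : ‖hf.toLp f‖ ^ 2 = ∫ x, ‖f x‖ ^ 2 ∂ν := by
    have h1 := inner_self_eq_norm_sq_to_K (𝕜 := ℂ) (hf.toLp f)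
    rw [hinner] at h1
    have h2 : ∀ x, f x * starRingEnd ℂ (f x) = ((‖f x‖ ^ 2 : ℝ) : ℂ) := fun x => by
      rw [Complex.mul_conj, Complex.normSq_eq_norm_sq]
    simp only [h2] at h1
    rw [integral_complex_ofReal] at h1
    rw [← RCLike.ofReal_pow] at h1
    exact (Complex.ofReal_injective h1).symm
  have hterm : ∀ i, ‖inner ℂ (((√c : ℝ) : ℂ)⁻¹ • (he i).toLp (e i)) (hf.toLp f)‖ ^ 2
      = c⁻¹ * ‖∫ x, f x * starRingEnd ℂ (e i x) ∂ν‖ ^ 2 := fun i => by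
    rw [inner_smul_left, hinner, norm_mul, mul_pow, map_inv₀, Complex.conj_ofReal, norm_inv,
      Complex.norm_real, Real.norm_of_nonneg (Real.sqrt_nonneg _), inv_pow, Real.sq_sqrt hc.le]
  simp only [hterm] at h
  rw [← Finset.mul_sum, hnorm, inv_mul_le_iff₀ hc] at h
  exact h

theorem integral_Ioc_exp_int_mul_div {n : ℕ} (hn : n ≠ 0) (m : ℤ) :
    ∫ t in Set.Ioc (-(Real.pi * n)) (Real.pi * n), Complex.exp (((m / n : ℝ) * t : ℝ) * Complex.I)
      = if m = 0 then ((2 * Real.pi * n : ℝ) : ℂ) else 0 := by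
  have hpos : 0 < Real.pi * n := by positivity
  rw [← intervalIntegral.integral_of_le (by linarith)]
  split_ifs with h
  · subst h
    simp
    ring
  · have hc : ((m / n : ℝ) : ℂ) * Complex.I ≠ 0 := by
      simp [h, hn]
    have h1 : ∀ t : ℝ, Complex.exp (((m / n : ℝ) * t : ℝ) * Complex.I)
        = Complex.exp ((((m / n : ℝ) : ℂ) * Complex.I) * t) := fun t => by
      push_cast; ring_nf
    simp only [h1]
    rw [integral_exp_mul_complex hc, div_eq_zero_iff, sub_eq_zero]
    left
    -- Frequency `m / n` over an interval of length `2πn` changes the exponent by `2πi m`, so the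
    -- endpoint values agree.
    rw [Complex.exp_eq_exp_iff_exists_int]
    refine ⟨m, ?_⟩
    have : (n : ℂ) ≠ 0 := by exact_mod_cast hn
    push_cast
    field_simp
    ring

/-- The lattice frequency `v / n`. -/
noncomputable def latticePoint (n : ℕ) (v : Fin N → ℤ) : EuclideanSpace ℝ (Fin N) :=
  WithLp.toLp 2 fun j => (v j : ℝ) / n

/-- The cube of side `2 π n`. -/
def cube (N n : ℕ) : Set (EuclideanSpace ℝ (Fin N)) :=
  WithLp.ofLp ⁻¹' Set.univ.pi fun _ => Set.Ioc (-(Real.pi * n)) (Real.pi * n)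

theorem volume_cube_ne_top (N n : ℕ) : volume (cube N n) ≠ ⊤ := by
  rw [cube, (PiLp.volume_preserving_ofLp (Fin N)).measure_preimage
    (MeasurableSet.univ_pi fun _ => measurableSet_Ioc).nullMeasurableSet, volume_pi_pi]
  exact ENNReal.prod_ne_top fun i _ => by simp

theorem ball_subset_cube (N n : ℕ) : Metric.ball 0 (Real.pi * n) ⊆ cube N n := by
  intro x hx i _
  have h1 := (PiLp.norm_apply_le x i).trans_lt (mem_ball_zero_iff.1 hx)
  rw [Real.norm_eq_abs, abs_lt] at h1
  exact ⟨h1.1, h1.2.le⟩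

theorem integral_cube_prod (N n : ℕ) (F : Fin N → ℝ → ℂ) :
    ∫ x in cube N n, ∏ j, F j (x j)
      = ∏ j, ∫ t in Set.Ioc (-(Real.pi * n)) (Real.pi * n), F j t := by
  have h := (PiLp.volume_preserving_ofLp (Fin N)).setIntegral_preimage_emb
    (MeasurableEquiv.toLp 2 (Fin N → ℝ)).symm.measurableEmbedding
    (fun y : Fin N → ℝ => ∏ j, F j (y j)) (Set.univ.pi fun _ => Set.Ioc (-(Real.pi * n)) (Real.pi * n))
  refine h.trans ?_
  rw [volume_pi, Measure.restrict_pi_pi]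
  exact integral_fintype_prod_eq_prod F

/-- The exponential of frequency `v / n`. -/
noncomputable def latticeExp (n : ℕ) (v : Fin N → ℤ) (x : EuclideanSpace ℝ (Fin N)) : ℂ :=
  Complex.exp ((inner ℝ (latticePoint n v) x : ℝ) * Complex.I)

theorem continuous_latticeExp (n : ℕ) (v : Fin N → ℤ) : Continuous (latticeExp n v) := by
  unfold latticeExp
  fun_prop

theorem norm_latticeExp (n : ℕ) (v : Fin N → ℤ) (x : EuclideanSpace ℝ (Fin N)) :
    ‖latticeExp n v x‖ = 1 :=
  Complex.norm_exp_ofReal_mul_I _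

/-- The integral factors over coordinates, and a coordinate in which the frequencies differ
contributes a full-period integral, which is zero. -/
theorem integral_latticeExp_mul_conj {n : ℕ} (hn : n ≠ 0) (v w : Fin N → ℤ) :
    ∫ x in cube N n, latticeExp n w x * starRingEnd ℂ (latticeExp n v x)
      = if v = w then (((2 * Real.pi * n) ^ N : ℝ) : ℂ) else 0 := by
  have h : ∀ x : EuclideanSpace ℝ (Fin N), latticeExp n w x * starRingEnd ℂ (latticeExp n v x)
      = ∏ j, Complex.exp ((((w j - v j : ℤ) / n : ℝ) * x j : ℝ) * Complex.I) := fun x => by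
    rw [latticeExp, latticeExp, ← Complex.exp_conj, ← Complex.exp_add, ← Complex.exp_sum]
    congr 1
    simp only [map_mul, Complex.conj_ofReal, Complex.conj_I, mul_neg, ← sub_eq_add_neg, ← sub_mul,
      ← Complex.ofReal_sub, ← inner_sub_left, ← Finset.sum_mul, ← Complex.ofReal_sum]
    congr 2
    rw [PiLp.inner_apply]
    refine Finset.sum_congr rfl fun j _ => ?_
    simp [latticePoint]
    ring
  simp only [h]
  rw [integral_cube_prod N n fun j t =>
    Complex.exp ((((w j - v j : ℤ) / n : ℝ) * t : ℝ) * Complex.I)]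
  simp only [integral_Ioc_exp_int_mul_div hn]
  split_ifs with hvw
  · subst hvw
    simp
  · obtain ⟨j, hj⟩ := Function.ne_iff.1 hvw
    exact Finset.prod_eq_zero (Finset.mem_univ j) (if_neg fun h => hj (sub_eq_zero.1 h).symm)

/-- Bessel's inequality for the Fourier coefficients of a function supported in a cube. -/
theorem sum_integral_mul_cos_sin_sq_le {n : ℕ} (hn : n ≠ 0) (Z : Finset (Fin N → ℤ))
    {f : EuclideanSpace ℝ (Fin N) → ℝ} (hf : MemLp f 2 volume)
    (hsupp : Function.support f ⊆ cube N n) :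
    ∑ v ∈ Z, ((∫ x, f x * Real.cos (inner ℝ (latticePoint n v) x)) ^ 2
        + (∫ x, f x * Real.sin (inner ℝ (latticePoint n v) x)) ^ 2)
      ≤ (2 * Real.pi * n) ^ N * ∫ x, f x ^ 2 := by
  have : IsFiniteMeasure (volume.restrict (cube N n)) :=
    ⟨by simpa using (volume_cube_ne_top N n).lt_top⟩
  have hfc : MemLp (fun x => (f x : ℂ)) 2 (volume.restrict (cube N n)) :=
    (hf.restrict _).ofReal
  have hb := sum_norm_integral_conj_mul_sq_le Z (ν := volume.restrict (cube N n))
    (e := fun v : Fin N → ℤ => latticeExp n v)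
    (fun v => MemLp.of_bound (continuous_latticeExp n v).aestronglyMeasurable 1
      (Filter.Eventually.of_forall fun x => (norm_latticeExp n v x).le))
    (c := (2 * Real.pi * n) ^ N) (by positivity) (integral_latticeExp_mul_conj hn) hfc
  have hout : ∀ {g : EuclideanSpace ℝ (Fin N) → ℝ}, (∀ x, f x = 0 → g x = 0) →
      ∫ x in cube N n, g x = ∫ x, g x := fun {g} hg =>
    setIntegral_eq_integral_of_forall_compl_eq_zero fun x hx =>
      hg x (by by_contra h; exact hx (hsupp h))
  have hint : ∀ v, Integrable (fun x => (f x : ℂ) * starRingEnd ℂ (latticeExp n v x))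
      (volume.restrict (cube N n)) := fun v => by
    refine (hfc.integrable (by norm_num)).mul_bdd (c := 1)
      (Complex.continuous_conj.comp (continuous_latticeExp n v)).aestronglyMeasurable
      (Filter.Eventually.of_forall fun x => ?_)
    rw [RCLike.norm_conj, norm_latticeExp]
  have hterm : ∀ v, ‖∫ x in cube N n, (f x : ℂ) * starRingEnd ℂ (latticeExp n v x)‖ ^ 2
      = (∫ x, f x * Real.cos (inner ℝ (latticePoint n v) x)) ^ 2
        + (∫ x, f x * Real.sin (inner ℝ (latticePoint n v) x)) ^ 2 := fun v => by
    have hre := Complex.reCLM.integral_comp_comm (hint v)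
    have him := Complex.imCLM.integral_comp_comm (hint v)
    rw [← Complex.normSq_eq_norm_sq, Complex.normSq_apply, ← pow_two, ← pow_two]
    rw [Complex.reCLM_apply] at hre
    rw [Complex.imCLM_apply] at him
    rw [← hre, ← him]
    have e1 : ∀ x, Complex.reCLM ((f x : ℂ) * starRingEnd ℂ (latticeExp n v x))
        = f x * Real.cos (inner ℝ (latticePoint n v) x) := fun x => by
      simp [latticeExp, Complex.exp_ofReal_mul_I_re]
    have e2 : ∀ x, Complex.imCLM ((f x : ℂ) * starRingEnd ℂ (latticeExp n v x))
        = -(f x * Real.sin (inner ℝ (latticePoint n v) x)) := fun x => by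
      simp [latticeExp, Complex.exp_ofReal_mul_I_im]
    simp only [e1, e2]
    rw [integral_neg, neg_sq, hout fun x hx => by simp [hx], hout fun x hx => by simp [hx]]
  simp only [hterm] at hb
  refine hb.trans_eq ?_
  congr 1
  simp only [Complex.norm_real, Real.norm_eq_abs, sq_abs]
  exact hout fun x hx => by simp [hx]

/-! ### Modulated cutoffs as trial functions. -/

theorem gradient_mul_apply {u v : EuclideanSpace ℝ (Fin N) → ℝ} {x : EuclideanSpace ℝ (Fin N)}
    (hu : DifferentiableAt ℝ u x) (hv : DifferentiableAt ℝ v x) :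
    gradient (fun y => u y * v y) x = u x • gradient v x + v x • gradient u x := by
  simp only [gradient]
  rw [fderiv_fun_mul hu hv]
  simp

theorem hasFDerivAt_inner_left (z x : EuclideanSpace ℝ (Fin N)) :
    HasFDerivAt (fun y => inner ℝ z y) (innerSL ℝ z) x :=
  (innerSL ℝ z).hasFDerivAt

theorem gradient_cos_inner (z x : EuclideanSpace ℝ (Fin N)) :
    gradient (fun y => Real.cos (inner ℝ z y)) x = (-Real.sin (inner ℝ z x)) • z := by
  rw [gradient, ((hasFDerivAt_inner_left z x).cos).fderiv, map_smul]
  congr 1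
  exact (InnerProductSpace.toDual ℝ _).symm_apply_apply z

theorem gradient_sin_inner (z x : EuclideanSpace ℝ (Fin N)) :
    gradient (fun y => Real.sin (inner ℝ z y)) x = Real.cos (inner ℝ z x) • z := by
  rw [gradient, ((hasFDerivAt_inner_left z x).sin).fderiv, map_smul]
  congr 1
  exact (InnerProductSpace.toDual ℝ _).symm_apply_apply z

theorem contDiff_cos_inner (z : EuclideanSpace ℝ (Fin N)) :
    ContDiff ℝ ∞ fun y => Real.cos (inner ℝ z y) :=
  Real.contDiff_cos.comp (innerSL ℝ z).contDiff

theorem contDiff_sin_inner (z : EuclideanSpace ℝ (Fin N)) :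
    ContDiff ℝ ∞ fun y => Real.sin (inner ℝ z y) :=
  Real.contDiff_sin.comp (innerSL ℝ z).contDiff

/-- The test function `χ cos ⟨z, ·⟩`. -/
noncomputable def cosTest (χ : testFunctions N) (z : EuclideanSpace ℝ (Fin N)) :
    testFunctions N :=
  ⟨fun x => χ.1 x * Real.cos (inner ℝ z x),
    χ.2.1.mul (contDiff_cos_inner z), χ.2.2.mul_right⟩

/-- The test function `χ sin ⟨z, ·⟩`. -/
noncomputable def sinTest (χ : testFunctions N) (z : EuclideanSpace ℝ (Fin N)) :
    testFunctions N :=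
  ⟨fun x => χ.1 x * Real.sin (inner ℝ z x),
    χ.2.1.mul (contDiff_sin_inner z), χ.2.2.mul_right⟩

/-- The cross terms `∓2χ cos sin ⟨z, ∇χ⟩` cancel in the sum. This is the real form of `|∇(χ
e^{i⟨z,·⟩})|²`. -/
theorem norm_gradient_cosTest_sq_add (χ : testFunctions N) (z x : EuclideanSpace ℝ (Fin N)) :
    ‖gradient (cosTest χ z).1 x‖ ^ 2 + ‖gradient (sinTest χ z).1 x‖ ^ 2
      = ‖gradient χ.1 x‖ ^ 2 + ‖z‖ ^ 2 * (χ.1 x * χ.1 x) := by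
  have hχ := (isTest_coe χ).differentiable x
  have h1 : gradient (cosTest χ z).1 x = _ := gradient_mul_apply hχ
    ((contDiff_cos_inner z).differentiable (by simp) x)
  have h2 : gradient (sinTest χ z).1 x = _ := gradient_mul_apply hχ
    ((contDiff_sin_inner z).differentiable (by simp) x)
  rw [h1, h2, gradient_cos_inner, gradient_sin_inner]
  simp only [← real_inner_self_eq_norm_sq, inner_add_left, inner_add_right, inner_smul_left,
    inner_smul_right, real_inner_comm z]
  have := Real.sin_sq_add_cos_sq (inner ℝ z x)
  simp only [conj_trivial]
  linear_combination (inner ℝ (gradient χ.1 x) (gradient χ.1 x) +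
    inner ℝ z z * (χ.1 x * χ.1 x)) * this

variable {ρ : EuclideanSpace ℝ (Fin N) → ℝ}

theorem massForm_cosTest_add_sinTest (hρ : Integrable ρ) (χ : testFunctions N)
    (z : EuclideanSpace ℝ (Fin N)) :
    massForm hρ (cosTest χ z) (cosTest χ z) + massForm hρ (sinTest χ z) (sinTest χ z)
      = massForm hρ χ χ := by
  simp only [massForm_apply]
  rw [← integral_add (integrable_mass hρ (cosTest χ z) (cosTest χ z))
    (integrable_mass hρ (sinTest χ z) (sinTest χ z))]
  congr 1
  ext x
  have := Real.sin_sq_add_cos_sq (inner ℝ z x)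
  simp only [cosTest, sinTest]
  linear_combination (ρ x * (χ.1 x * χ.1 x)) * this

theorem energyForm_cosTest_add_sinTest (hρ : Integrable ρ) (χ : testFunctions N)
    (z : EuclideanSpace ℝ (Fin N)) :
    energyForm hρ (cosTest χ z) (cosTest χ z) + energyForm hρ (sinTest χ z) (sinTest χ z)
      = energyForm hρ χ χ + ‖z‖ ^ 2 * massForm hρ χ χ := by
  simp only [massForm_apply, energyForm_apply]
  rw [← integral_add (integrable_energy hρ (cosTest χ z) (cosTest χ z))
    (integrable_energy hρ (sinTest χ z) (sinTest χ z)), ← integral_const_mul,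
    ← integral_add (integrable_energy hρ χ χ) ((integrable_mass hρ χ χ).const_mul _)]
  congr 1
  ext x
  simp only [real_inner_self_eq_norm_sq]
  linear_combination ρ x * norm_gradient_cosTest_sq_add χ z x

/-- The summands are squared Fourier coefficients of `ρφχ`, which lives in the cube, and `∫(ρφχ)² ≤
M ∫ρφ² = M`. This is where the upper bound on the density enters. -/
theorem sum_massForm_cosTest_sinTest_sq_le (hρ : Integrable ρ) (h0 : 0 ≤ᵐ[volume] ρ) {M : ℝ}
    (hM : ∀ᵐ x, ρ x ≤ M) {n : ℕ} (hn : n ≠ 0) (Z : Finset (Fin N → ℤ)) {χ : testFunctions N}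
    (hχ : ∀ x, χ.1 x ∈ Set.Icc 0 1) (hsupp : Function.support χ.1 ⊆ cube N n)
    {φ : testFunctions N} (hφ : massForm hρ φ φ = 1) :
    ∑ v ∈ Z, (massForm hρ φ (cosTest χ (latticePoint n v)) ^ 2
        + massForm hρ φ (sinTest χ (latticePoint n v)) ^ 2)
      ≤ (2 * Real.pi * n) ^ N * M := by
  have hle : ∀ᵐ x, (ρ x * (φ.1 x * χ.1 x)) ^ 2 ≤ M * (ρ x * (φ.1 x * φ.1 x)) := by
    filter_upwards [h0, hM] with x hx0 hxM
    have hx0' : 0 ≤ ρ x := hx0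
    have h1 : χ.1 x ^ 2 ≤ 1 := by
      have := hχ x
      exact pow_le_one₀ this.1 this.2
    calc (ρ x * (φ.1 x * χ.1 x)) ^ 2 = ρ x * (ρ x * (φ.1 x) ^ 2) * χ.1 x ^ 2 := by ring
      _ ≤ ρ x * (ρ x * (φ.1 x) ^ 2) * 1 := by gcongr
      _ ≤ M * (ρ x * (φ.1 x) ^ 2) * 1 := by gcongr
      _ = _ := by ring
  have hmeas : AEStronglyMeasurable (fun x => ρ x * (φ.1 x * χ.1 x)) volume :=
    (integrable_mass hρ φ χ).aestronglyMeasurable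
  have hsq : Integrable fun x => (ρ x * (φ.1 x * χ.1 x)) ^ 2 := by
    refine ((integrable_mass hρ φ φ).const_mul M).mono' (hmeas.pow 2) ?_
    filter_upwards [hle] with x hx
    rwa [Real.norm_of_nonneg (sq_nonneg _)]
  have hb := sum_integral_mul_cos_sin_sq_le hn Z ((memLp_two_iff_integrable_sq hmeas).2 hsq)
    (fun x hx => hsupp fun h => hx (by simp [h]))
  have e1 : ∀ v, massForm hρ φ (cosTest χ (latticePoint n v))
      = ∫ x, ρ x * (φ.1 x * χ.1 x) * Real.cos (inner ℝ (latticePoint n v) x) := fun v => by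
    rw [massForm_apply]
    congr 1; ext x; simp only [cosTest]; ring
  have e2 : ∀ v, massForm hρ φ (sinTest χ (latticePoint n v))
      = ∫ x, ρ x * (φ.1 x * χ.1 x) * Real.sin (inner ℝ (latticePoint n v) x) := fun v => by
    rw [massForm_apply]
    congr 1; ext x; simp only [sinTest]; ring
  simp only [e1, e2]
  refine hb.trans ?_
  gcongr
  calc _ ≤ ∫ x, M * (ρ x * (φ.1 x * φ.1 x)) :=
        integral_mono_ae hsq ((integrable_mass hρ φ φ).const_mul M) hle
    _ = M := by rw [integral_const_mul, ← massForm_apply hρ, hφ, mul_one]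

/-- The discrete form of Kröger's inequality. -/
theorem mul_card_sub_le_of_lt_eigenvalue (hρ : Integrable ρ) (h0 : 0 ≤ᵐ[volume] ρ) {M : ℝ}
    (hM : ∀ᵐ x, ρ x ≤ M) (hM0 : 0 ≤ M) {n : ℕ} (hn : n ≠ 0) (Z : Finset (Fin N → ℤ))
    {χ : testFunctions N} (hχ : ∀ x, χ.1 x ∈ Set.Icc 0 1)
    (hsupp : Function.support χ.1 ⊆ cube N n) {μ : ℝ} (hμ : 0 ≤ μ) {k : ℕ}
    (hlt : ENNReal.ofReal μ < eigenvalue k ρ) :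
    μ * (Z.card * massForm hρ χ χ - k * ((2 * Real.pi * n) ^ N * M))
      ≤ Z.card * energyForm hρ χ χ + (∑ v ∈ Z, ‖latticePoint n v‖ ^ 2) * massForm hρ χ χ := by
  classical
  -- All trial functions are treated at once, so that one set `t` serves every frequency and Bessel
  -- can be applied to each `φ ∈ t`.
  obtain ⟨t, ht1, ht2, ht3⟩ := exists_finset_test_of_lt_eigenvalue hρ h0 hμ hlt
    ((Z.image fun v => cosTest χ (latticePoint n v)) ∪
      Z.image fun v => sinTest χ (latticePoint n v))
  have hv : ∀ v ∈ Z, μ * (massForm hρ χ χ - ∑ φ ∈ t,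
      (massForm hρ φ (cosTest χ (latticePoint n v)) ^ 2
        + massForm hρ φ (sinTest χ (latticePoint n v)) ^ 2))
      ≤ energyForm hρ χ χ + ‖latticePoint n v‖ ^ 2 * massForm hρ χ χ := fun v hv => by
    have hc := ht3 _ (Finset.mem_union_left _ (Finset.mem_image_of_mem _ hv))
    have hs := ht3 _ (Finset.mem_union_right _ (Finset.mem_image_of_mem _ hv))
    rw [← energyForm_cosTest_add_sinTest, ← massForm_cosTest_add_sinTest hρ χ (latticePoint n v),
      Finset.sum_add_distrib]
    linarith
  have hsum := Finset.sum_le_sum hv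
  rw [← Finset.mul_sum, Finset.sum_sub_distrib, Finset.sum_add_distrib, Finset.sum_const,
    Finset.sum_const, nsmul_eq_mul, nsmul_eq_mul, ← Finset.sum_mul, Finset.sum_comm] at hsum
  refine le_trans (mul_le_mul_of_nonneg_left (sub_le_sub_left ?_ _) hμ) hsum
  calc _ ≤ ∑ φ ∈ t, (2 * Real.pi * n) ^ N * M := Finset.sum_le_sum fun φ hφ =>
        sum_massForm_cosTest_sinTest_sq_le hρ h0 hM hn Z hχ hsupp (ht2 φ hφ)
    _ = t.card * ((2 * Real.pi * n) ^ N * M) := by rw [Finset.sum_const, nsmul_eq_mul]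
    _ ≤ _ := by gcongr

/-! ### Riemann sums over frequencies and removal of the cutoff. -/

open Filter Topology

/-- The lattice frequencies of norm at most `r`. -/
noncomputable def latticeBall (N n : ℕ) (r : ℝ) : Finset (Fin N → ℤ) := by
  classical
  exact (Fintype.piFinset fun _ => Finset.Icc (-⌈r * n⌉) ⌈r * n⌉).filter
    fun v => ‖latticePoint n v‖ ≤ r

/-- The box in the definition serves only finiteness: the norm bound already bounds each coordinate.
-/
theorem mem_latticeBall {n : ℕ} (hn : n ≠ 0) {r : ℝ} {v : Fin N → ℤ} :
    v ∈ latticeBall N n r ↔ ‖latticePoint n v‖ ≤ r := by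
  rw [latticeBall, Finset.mem_filter, and_iff_right_iff_imp, Fintype.mem_piFinset]
  intro h j
  have hn' : (0 : ℝ) < n := by positivity
  have h1 : |(v j : ℝ)| / n ≤ r := by
    have := (PiLp.norm_apply_le (latticePoint n v) j).trans h
    simpa [latticePoint, abs_div] using this
  have h2 : |(v j : ℝ)| ≤ ⌈r * n⌉ := ((div_le_iff₀ hn').1 h1).trans (Int.le_ceil _)
  rw [Finset.mem_Icc, ← abs_le]
  exact_mod_cast h2

open scoped Pointwise in
/-- Convergence of Riemann sums over lattice points in a ball. -/
theorem tendsto_sum_latticeBall (N : ℕ) (r : ℝ) {F : EuclideanSpace ℝ (Fin N) → ℝ}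
    (hF : Continuous F) :
    Tendsto (fun n : ℕ => (∑ v ∈ latticeBall N n r, F (latticePoint n v)) / (n : ℝ) ^ N) atTop
      (𝓝 (∫ x in Metric.closedBall 0 r, F x)) := by
  set s : Set (Fin N → ℝ) := WithLp.toLp 2 ⁻¹' Metric.closedBall (0 : EuclideanSpace ℝ (Fin N)) r
    with hs
  have hcont : Continuous (WithLp.toLp 2 : (Fin N → ℝ) → EuclideanSpace ℝ (Fin N)) :=
    PiLp.continuous_toLp 2 _
  have hmem : ∀ y : Fin N → ℝ, y ∈ s ↔ ‖WithLp.toLp 2 y‖ ≤ r := fun y => mem_closedBall_zero_iff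
  have hb : Bornology.IsBounded s := by
    refine isBounded_iff_forall_norm_le.2 ⟨r, fun y hy => ?_⟩
    have hr : 0 ≤ r := (norm_nonneg _).trans ((hmem y).1 hy)
    exact (pi_norm_le_iff_of_nonneg hr).2 fun j =>
      (PiLp.norm_apply_le (WithLp.toLp 2 y) j).trans ((hmem y).1 hy)
  have hm : MeasurableSet s := (Metric.isClosed_closedBall.preimage hcont).measurableSet
  -- Convexity provides the null frontier required for convergence of the Riemann sums.
  have hconv : Convex ℝ s :=
    (convex_closedBall (0 : EuclideanSpace ℝ (Fin N)) r).linear_preimage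
      (WithLp.linearEquiv 2 ℝ (Fin N → ℝ)).symm.toLinearMap
  have h := tendsto_tsum_div_pow_atTop_integral s (fun y => F (WithLp.toLp 2 y))
    (hF.comp hcont) hb hm (hconv.addHaar_frontier volume)
  have hint : ∫ y in s, F (WithLp.toLp 2 y) = ∫ x in Metric.closedBall 0 r, F x :=
    (PiLp.volume_preserving_toLp (Fin N)).setIntegral_preimage_emb
      (MeasurableEquiv.toLp 2 (Fin N → ℝ)).measurableEmbedding F _
  rw [hint, Fintype.card_fin] at h
  refine h.congr' ?_
  filter_upwards [eventually_ne_atTop 0] with n hn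
  have hn' : (n : ℝ) ≠ 0 := by exact_mod_cast hn
  have : NeZero n := ⟨hn⟩
  congr 1
  rw [← Finset.tsum_subtype]
  have hf : ∀ v : latticeBall N n r, (fun j => ((v : Fin N → ℤ) j : ℝ) / n) ∈
      s ∩ ((n : ℝ)⁻¹ • (Submodule.span ℤ (Set.range (Pi.basisFun ℝ (Fin N))) :
        Set (Fin N → ℝ))) := fun v =>
    ⟨(hmem _).2 ((mem_latticeBall hn).1 v.2),
      BoxIntegral.unitPartition.mem_smul_span_iff.2 fun j => ⟨(v : Fin N → ℤ) j, by
        simp [mul_div_cancel₀ _ hn']⟩⟩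
  let e := Equiv.ofBijective (fun v : latticeBall N n r => (⟨_, hf v⟩ : ↑(s ∩ _))) (by
    constructor
    · intro v w hvw
      refine Subtype.ext (funext fun j => ?_)
      have := congrFun (congrArg Subtype.val hvw) j
      simpa [div_left_inj' hn'] using this
    · rintro ⟨y, hy1, hy2⟩
      choose v hv using BoxIntegral.unitPartition.mem_smul_span_iff.1 hy2
      have hy : (fun j => (v j : ℝ) / n) = y := funext fun j => by
        rw [div_eq_iff hn', mul_comm, ← hv j]; rfl
      refine ⟨⟨v, (mem_latticeBall hn).2 ?_⟩, Subtype.ext hy⟩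
      rw [latticePoint, hy]
      exact (hmem y).1 hy1)
  exact (e.tsum_eq fun x => F (WithLp.toLp 2 x.1)).symm

theorem integral_closedBall_one [NeZero N] {r : ℝ} (hr : 0 ≤ r) :
    ∫ _ in Metric.closedBall (0 : EuclideanSpace ℝ (Fin N)) r, (1 : ℝ)
      = unitBallVolume N * r ^ N := by
  rw [setIntegral_const, smul_eq_mul, mul_one, Measure.addHaar_real_closedBall _ _ hr,
    finrank_euclideanSpace_fin, mul_comm]
  rfl

/-- Polar coordinates reduce this to `N ω_N ∫₀^r t^(N+1) dt`. -/
theorem integral_closedBall_norm_sq [NeZero N] {r : ℝ} (hr : 0 ≤ r) :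
    ∫ x in Metric.closedBall (0 : EuclideanSpace ℝ (Fin N)) r, ‖x‖ ^ 2
      = unitBallVolume N * (N / (N + 2) * r ^ (N + 2)) := by
  have hN : N ≠ 0 := NeZero.ne N
  have : Nonempty (Fin N) := ⟨0⟩
  have h := integral_fun_norm_addHaar (volume : Measure (EuclideanSpace ℝ (Fin N)))
    ((Set.Iic r).indicator fun t => t ^ 2)
  have e1 : (fun x : EuclideanSpace ℝ (Fin N) => (Set.Iic r).indicator (fun t => t ^ 2) ‖x‖)
      = (Metric.closedBall 0 r).indicator fun x => ‖x‖ ^ 2 := by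
    ext x
    simp [Set.indicator]
  have e2 : ∀ y : ℝ, y ^ (N - 1) • (Set.Iic r).indicator (fun t => t ^ 2) y
      = (Set.Iic r).indicator (fun t => t ^ (N + 1)) y := fun y => by
    by_cases hy : y ≤ r
    · simp only [Set.indicator, Set.mem_Iic, hy, if_true, smul_eq_mul, ← pow_add]
      congr 1; omega
    · simp [Set.indicator, hy]
  rw [e1, integral_indicator Metric.isClosed_closedBall.measurableSet] at h
  rw [h, finrank_euclideanSpace_fin]
  simp only [e2]
  rw [setIntegral_indicator measurableSet_Iic, Set.Ioi_inter_Iic,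
    ← intervalIntegral.integral_of_le hr, integral_pow]
  simp only [nsmul_eq_mul, smul_eq_mul, unitBallVolume, Measure.real]
  have : (N : ℝ) + 2 ≠ 0 := by positivity
  push_cast
  rw [zero_pow (by omega)]
  field_simp
  ring

/-- Smooth cutoffs exhausting the space, with gradients tending to zero. -/
theorem exists_cutoff_sequence (N : ℕ) :
    ∃ χ : ℕ → testFunctions N, (∀ n x, (χ n).1 x ∈ Set.Icc 0 1) ∧
      (∀ n, Function.support (χ n).1 ⊆ cube N n) ∧
      (∀ x, Tendsto (fun n => (χ n).1 x) atTop (𝓝 1)) ∧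
      ∃ C, ∀ n ≠ 0, ∀ x, ‖gradient (χ n).1 x‖ ≤ C / n := by
  let b : ContDiffBump (0 : EuclideanSpace ℝ (Fin N)) := ⟨1, 2, by norm_num, by norm_num⟩
  have hb : IsTest b := ⟨b.contDiff, b.hasCompactSupport⟩
  -- The index `0` is set apart because `(0 : ℝ)⁻¹ = 0` would make the rescaled bump constant,
  -- without support in the degenerate cube.
  have hex : ∀ n : ℕ, ∃ χ : testFunctions N, (n = 0 → χ = 0) ∧
      (n ≠ 0 → χ.1 = fun x => b ((n : ℝ)⁻¹ • x)) := fun n => by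
    by_cases hn : n = 0
    · exact ⟨0, fun _ => rfl, fun h => (h hn).elim⟩
    · refine ⟨⟨fun x => b ((n : ℝ)⁻¹ • x), hb.1.comp (contDiff_const_smul _),
        hb.2.comp_smul (by simpa using hn)⟩, fun h => (hn h).elim, fun _ => rfl⟩
  choose χ hχ0 hχ using hex
  obtain ⟨C, hC⟩ := hb.hasCompactSupport_gradient.exists_bound_of_continuous hb.continuous_gradient
  refine ⟨χ, fun n x => ?_, fun n => ?_, fun x => ?_, C, fun n hn x => ?_⟩
  · by_cases hn : n = 0
    · simp [hχ0 n hn]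
    · rw [hχ n hn]
      exact ⟨b.nonneg, b.le_one⟩
  · by_cases hn : n = 0
    · simp [hχ0 n hn]
    · refine subset_trans (fun x hx => ?_) (ball_subset_cube N n)
      rw [hχ n hn] at hx
      have hx' : (n : ℝ)⁻¹ • x ∈ Function.support b := hx
      rw [b.support_eq, mem_ball_zero_iff, norm_smul, norm_inv, Real.norm_natCast,
        inv_mul_lt_iff₀ (by positivity)] at hx'
      rw [mem_ball_zero_iff]
      -- The rescaled bump lives in the ball of radius `2n`, and `2 ≤ π`.
      refine hx'.trans_le ?_
      rw [mul_comm]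
      exact mul_le_mul_of_nonneg_right (by linarith [Real.pi_gt_three] : (2 : ℝ) ≤ _)
        n.cast_nonneg
  · refine tendsto_const_nhds.congr' ?_
    obtain ⟨m, hm⟩ := exists_nat_ge ‖x‖
    filter_upwards [eventually_ge_atTop m, eventually_ne_atTop 0] with n hnm hn
    rw [hχ n hn]
    refine (b.one_of_mem_closedBall ?_).symm
    rw [mem_closedBall_zero_iff, norm_smul, norm_inv, Real.norm_natCast,
      inv_mul_le_iff₀ (by positivity)]
    have : (m : ℝ) ≤ n := by exact_mod_cast hnm
    change ‖x‖ ≤ n * 1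
    linarith
  · have h := hC ((n : ℝ)⁻¹ • x)
    rw [gradient, LinearIsometryEquiv.norm_map] at h ⊢
    rw [hχ n hn, fderiv_comp_smul, norm_smul, norm_inv, Real.norm_natCast, div_eq_inv_mul]
    gcongr

/-- Kröger's inequality at radius `r` in frequency space. -/
theorem mul_volume_sub_le_of_lt_eigenvalue [NeZero N] {ρ : EuclideanSpace ℝ (Fin N) → ℝ}
    (hρ : Integrable ρ) (h0 : 0 ≤ᵐ[volume] ρ) {M : ℝ} (hM : ∀ᵐ x, ρ x ≤ M) (hM0 : 0 ≤ M)
    {μ : ℝ} (hμ : 0 ≤ μ) {k : ℕ} (hlt : ENNReal.ofReal μ < eigenvalue k ρ) {r : ℝ} (hr : 0 ≤ r) :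
    μ * (unitBallVolume N * r ^ N * (∫ x, ρ x) - k * ((2 * Real.pi) ^ N * M))
      ≤ unitBallVolume N * (N / (N + 2) * r ^ (N + 2)) * ∫ x, ρ x := by
  obtain ⟨χ, hχ1, hχ2, hχ3, C, hC⟩ := exists_cutoff_sequence N
  have hmass : Tendsto (fun n => massForm hρ (χ n) (χ n)) atTop (𝓝 (∫ x, ρ x)) := by
    refine tendsto_integral_of_dominated_convergence ρ
      (fun n => (integrable_mass hρ (χ n) (χ n)).aestronglyMeasurable) hρ (fun n => ?_) ?_
    · filter_upwards [h0] with x hx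
      have hx0 : 0 ≤ ρ x := hx
      have h1 := hχ1 n x
      rw [Real.norm_of_nonneg (mul_nonneg hx0 (mul_self_nonneg _))]
      exact mul_le_of_le_one_right hx0 (mul_le_one₀ h1.2 h1.1 h1.2)
    · refine Eventually.of_forall fun x => ?_
      simpa using ((hχ3 x).mul (hχ3 x)).const_mul (ρ x)
  have henergy : Tendsto (fun n => energyForm hρ (χ n) (χ n)) atTop (𝓝 0) := by
    have hlim : Tendsto (fun n : ℕ => (∫ x, ρ x) * (C / n) ^ 2) atTop (𝓝 0) := by
      simpa using ((tendsto_const_div_atTop_nhds_zero_nat C).pow 2).const_mul (∫ x, ρ x)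
    refine squeeze_zero' (Eventually.of_forall fun n => energyForm_self_nonneg hρ h0 _) ?_ hlim
    filter_upwards [eventually_ne_atTop 0] with n hn
    rw [energyForm_self, ← integral_mul_const]
    refine integral_mono_ae ?_ (hρ.mul_const _) ?_
    · simpa only [real_inner_self_eq_norm_sq] using integrable_energy hρ (χ n) (χ n)
    · filter_upwards [h0] with x hx
      exact mul_le_mul_of_nonneg_left (pow_le_pow_left₀ (norm_nonneg _) (hC n hn x) 2) hx
  have hcard := tendsto_sum_latticeBall N r (F := fun _ => 1) continuous_const
  have hnorm := tendsto_sum_latticeBall N r (F := fun x => ‖x‖ ^ 2) (by fun_prop)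
  rw [integral_closedBall_one hr] at hcard
  rw [integral_closedBall_norm_sq hr] at hnorm
  -- Both sides are divided by `n ^ N`. The number of frequencies then stays bounded, so the energy
  -- of the cutoff drops out.
  have hl := ((hcard.mul hmass).sub_const (k * ((2 * Real.pi) ^ N * M))).const_mul μ
  have hu := (hcard.mul henergy).add (hnorm.mul hmass)
  rw [mul_zero, zero_add] at hu
  refine le_of_tendsto_of_tendsto hl hu ?_
  filter_upwards [eventually_ne_atTop 0] with n hn
  have h := mul_card_sub_le_of_lt_eigenvalue hρ h0 hM hM0 hn (latticeBall N n r) (hχ1 n)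
    (hχ2 n) hμ hlt
  have hn' : (0 : ℝ) < (n : ℝ) ^ N := by positivity
  rw [← div_le_div_iff_of_pos_right hn'] at h
  simp only [Finset.sum_const, nsmul_eq_mul, mul_one]
  rw [mul_pow] at h
  convert! h using 1 <;> field_simp

/-! ### Optimization of the radius. -/

theorem ae_le_toReal_eLpNorm_top {α : Type*} [MeasurableSpace α] {ν : Measure α} {f : α → ℝ}
    (hf : MemLp f ⊤ ν) : ∀ᵐ x ∂ν, f x ≤ (eLpNorm f ⊤ ν).toReal := by
  filter_upwards [ae_le_eLpNormEssSup (f := f) (μ := ν)] with x hx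
  rw [← eLpNorm_exponent_top] at hx
  have := ENNReal.toReal_mono hf.eLpNorm_ne_top hx
  rw [toReal_enorm] at this
  exact (le_abs_self _).trans this

/-- Kröger's bound for an integrable density with values in `[0, M]`. -/
theorem eigenvalue_le_of_density [NeZero N] {ρ : EuclideanSpace ℝ (Fin N) → ℝ}
    (hρ : Integrable ρ) (h0 : 0 ≤ᵐ[volume] ρ) {M : ℝ} (hM : ∀ᵐ x, ρ x ≤ M) (hM0 : 0 < M)
    (hm : 0 < ∫ x, ρ x) (k : ℕ) :
    eigenvalue k ρ ≤ ENNReal.ofReal (4 * Real.pi ^ 2 *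
      ((((N : ℝ) + 2) * k) / (2 * unitBallVolume N) * (M / ∫ x, ρ x)) ^ ((2 : ℝ) / N)) := by
  have hN : (0 : ℝ) < N := by exact_mod_cast NeZero.pos N
  have hB : 0 < unitBallVolume N :=
    ENNReal.toReal_pos (Metric.measure_ball_pos _ _ one_pos).ne' measure_ball_lt_top.ne
  set B := unitBallVolume N
  set m := ∫ x, ρ x
  set X := (((N : ℝ) + 2) * k) / (2 * B) * (M / m) with hX
  by_contra! hlt
  -- A finite `μ` strictly between also covers an infinite eigenvalue, so no admissible subspace has
  -- to be constructed.
  obtain ⟨μ, hμ1, hμ2⟩ := ENNReal.lt_iff_exists_nnreal_btwn.1 hlt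
  rw [← ENNReal.ofReal_coe_nnreal] at hμ1 hμ2
  have key : ∀ {r : ℝ}, 0 ≤ r → _ := fun {r} hr =>
    mul_volume_sub_le_of_lt_eigenvalue hρ h0 hM hM0.le μ.2 hμ2 hr
  have hX0 : 0 ≤ X := by positivity
  rw [ENNReal.ofReal_lt_ofReal_iff_of_nonneg (by positivity)] at hμ1
  have hμ0 : (0 : ℝ) < μ := lt_of_le_of_lt (by positivity) hμ1
  -- For `k = 0` the optimal radius degenerates to zero. The radius `√μ` instead gives `μ ≤ N/(N+2)
  -- μ` up to a positive factor, which is absurd.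
  rcases Nat.eq_zero_or_pos k with hk | hk
  · have hr : 0 < √(μ : ℝ) := Real.sqrt_pos.2 hμ0
    have h := key hr.le
    rw [pow_add, Real.sq_sqrt hμ0.le, hk, Nat.cast_zero, zero_mul, sub_zero] at h
    have hlt1 : (N : ℝ) / (N + 2) < 1 := by
      rw [div_lt_one (by positivity)]; linarith
    have hp : 0 < μ * (B * √(μ : ℝ) ^ N * m) := by positivity
    have : μ * (B * √(μ : ℝ) ^ N * m) ≤ N / (N + 2) * (μ * (B * √(μ : ℝ) ^ N * m)) := by
      refine h.trans_eq ?_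
      ring
    nlinarith
  · have hk' : (0 : ℝ) < k := by exact_mod_cast hk
    have hXpos : 0 < X := by positivity
    -- This minimizes the resulting bound on `μ`: the subtracted term is then `2/(N+2)` of `B r^N
    -- m`, and the remaining `N/(N+2)` cancels against the right side, leaving `μ ≤ r²`.
    set r := 2 * Real.pi * X ^ ((1 : ℝ) / N) with hr
    have hr0 : 0 < r := by positivity
    have hrN : r ^ N = (2 * Real.pi) ^ N * X := by
      rw [hr, mul_pow, ← Real.rpow_natCast (X ^ _), ← Real.rpow_mul hX0,
        one_div_mul_cancel hN.ne', Real.rpow_one]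
    have hr2 : r ^ 2 = 4 * Real.pi ^ 2 * X ^ ((2 : ℝ) / N) := by
      rw [hr, mul_pow, ← Real.rpow_natCast (X ^ _), ← Real.rpow_mul hX0]
      congr 2
      · ring
      · push_cast; ring
    have hkM : k * M = 2 * B * m * X / (N + 2) := by
      rw [hX]; field_simp
    have h := key hr0.le
    rw [← hr2] at hμ1
    simp only [NNReal.val_eq_coe] at h
    have e1 : B * r ^ N * m - k * ((2 * Real.pi) ^ N * M)
        = N / (N + 2) * (B * r ^ N * m) := by
      rw [show (k : ℝ) * ((2 * Real.pi) ^ N * M) = (2 * Real.pi) ^ N * (k * M) by ring, hkM, hrN]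
      field_simp
      ring
    have e2 : B * (N / (N + 2) * r ^ (N + 2)) * m
        = r ^ 2 * (N / (N + 2) * (B * r ^ N * m)) := by ring
    have hp : 0 < N / (N + 2) * (B * r ^ N * m) := by positivity
    rw [e2] at h
    change μ * (B * r ^ N * m - k * ((2 * Real.pi) ^ N * M)) ≤ _ at h
    rw [e1] at h
    exact (le_of_mul_le_mul_right h hp).not_gt hμ1

end DensityEigenvalue

theorem theorem3 (N : ℕ) (hN : 2 ≤ N) (ρ : EuclideanSpace ℝ (Fin N) → ℝ)
    (hρ1 : MemLp ρ 1 volume) (hρinf : MemLp ρ ⊤ volume)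
    (hρ_nonneg : 0 ≤ᵐ[volume] ρ) (hρ_ne : ¬ ρ =ᵐ[volume] 0) :
    ∀ k : ℕ, DensityEigenvalue.eigenvalue k ρ ≤
      ENNReal.ofReal (4 * Real.pi ^ 2 *
        ((((N : ℝ) + 2) * k) / (2 * DensityEigenvalue.unitBallVolume N) *
          ((eLpNorm ρ ⊤ volume).toReal / (eLpNorm ρ 1 volume).toReal)) ^ ((2 : ℝ) / N)) := by
  intro k
  have : NeZero N := ⟨by omega⟩
  have hρ : Integrable ρ := memLp_one_iff_integrable.1 hρ1
  have hm : (eLpNorm ρ 1 volume).toReal = ∫ x, ρ x := by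
    rw [eLpNorm_one_eq_lintegral_enorm, ← integral_norm_eq_lintegral_enorm hρ.1]
    refine integral_congr_ae ?_
    filter_upwards [hρ_nonneg] with x hx using Real.norm_of_nonneg hx
  have hpos : ∀ p : ENNReal, p ≠ 0 → MemLp ρ p volume → 0 < (eLpNorm ρ p volume).toReal :=
    fun p hp h => ENNReal.toReal_pos (fun h' => hρ_ne ((eLpNorm_eq_zero_iff h.1 hp).1 h'))
      h.eLpNorm_ne_top
  have hm0 := hpos 1 one_ne_zero hρ1
  rw [hm] at hm0 ⊢
  exact DensityEigenvalue.eigenvalue_le_of_density hρ hρ_nonneg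
    (DensityEigenvalue.ae_le_toReal_eLpNorm_top hρinf)
    (hpos ⊤ ENNReal.top_ne_zero hρinf) hm0 k
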